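/- Graphs are simple, undirected, countable and locally finite. For a graph $G$ let $P_G$ be the transition matrix of its lazy simple random walk: $P_G(x,y)=\frac{1}{2\deg_G(x)}$ if $\{x,y\}$ is an edge, $P_G(x,x)=\frac12$ if $\deg_G(x)\ge 1$, $P_G(x,x)=1$ if $x$ is isolated, and $P_G(x,y)=0$ otherwise. For a vertex $o$ of $G$, the local spectral measure $\mu_{(G,o)}$ is the probability measure on $[0,1]$ characterized by $\int_0^1\lambda^t\,\mu_{(G,o)}(d\lambda)=P_G^t(o,o)$ for all integers $t\ge 0$. For a finite graph $G$ with $N$ vertices, $\mu_G=\frac1N\sum_{i=1}^N\delta_{\lambda_i(G)}$, where $\lambda_1(G),\dots,\lambda_N(G)$ are the eigenvalues of $P_G$ counted with multiplicity. If $G$ is connected, its spectral radius is $\rho(G)=\lim_{t\to\infty}P_G^t(o,o)^{1/t}$, which does not depend on the vertex $o$. Let $\mathscr G_\bullet$ be the space of connected rooted graphs $(G,o)$ up to root-preserving isomorphism, with the local metric $d((G,o),(G',o'))=\frac1{1+r}$, where $r\in\{0,1,2,\dots\}\cup\{\infty\}$ is the supremum of the integers $t\ge0$ for which the balls of radius $t$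 around the roots (as induced rooted subgraphs) are isomorphic, and with its Borel $\sigma$-algebra. Finite nonempty graphs $G_n=(V_n,E_n)$, $n\ge1$, have local weak limit $\mathcal L$, a Borel probability measure on $\mathscr G_\bullet$, if the measures $\frac{1}{|V_n|}\sum_{x\in V_n}\delta_{(G_n,x)}$ converge weakly to $\mathcal L$ as $n\to\infty$, where $(G_n,x)$ stands for the connected component of $x$ in $G_n$, rooted at $x$. **Corollary (unit spectral radius implies poor spectral expansion).** Let $G_n=(V_n,E_n)$, $n\ge 1$, be finite nonempty graphs having a local weak limit $\mathcal L$ such that $\mathcal L(\rho(G)=1)=1$. Then, for every real $\rho<1$, $$\liminf_{n\to\infty}\ \mu_{G_n}([\rho,1])>0 .$$ Moreover, for every real $\rho<1$, $$\sup_{n\ge1}\ \frac{\bigl|\{x\in V_n:\ \mu_{(G_n,x)}([\rho,1])\le\varepsilon\}\bigr|}{|V_n|}\ \longrightarrow\ 0\qquad\text{as }\varepsilon\to0^+ .$$ -/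

import Mathlib

open Filter MeasureTheory Topology
open scoped ENNReal

universe u

/-! ### Lazy simple random walk on a graph -/

section Walk

variable {V : Type u} (G : SimpleGraph V)

open Classical in
/-- Transition kernel `P_G` of the lazy simple random walk on a locally finite graph `G`: stay put
with probability `1/2`, otherwise jump to a uniformly chosen neighbor. An isolated vertex has
nowhere to jump to, so the walk stays there with probability `1` (thus `P_G` is always
stochastic). -/
noncomputable def transition (x y : V) : ℝ :=
  if G.Adj x y then 1 / (2 * ((G.neighborSet x).ncard : ℝ))
  else if x = y then (if (G.neighborSet x).Nonempty then 1 / 2 else 1)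
  else 0

open Classical in
/-- The `t`-step transition probabilities `P_G^t(x,y)`. On a locally finite graph, the sum
has only finitely many nonzero terms. -/
noncomputable def transitionPow : ℕ → V → V → ℝ
  | 0, x, y => if x = y then 1 else 0
  | t + 1, x, y => ∑' z, transition G x z * transitionPow t z y

/-- `μ` is a probability measure on `[0,1]` (seen as a measure on `ℝ`) whose `t`-th moment is the
return probability `P_G^t(o,o)`, for every `t ≥ 0`. -/
structure IsLocalSpectralMeasure (o : V) (μ : Measure ℝ) : Prop where
  isProbabilityMeasure : IsProbabilityMeasure μ
  measure_Icc : μ (Set.Icc 0 1) = 1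
  moment : ∀ t : ℕ, ∫ l, l ^ t ∂μ = transitionPow G t o o

open Classical in
/-- The local spectral measure `μ_{(G,o)}`: the probability measure on `[0,1]` characterized
by `∫ λ^t dμ_{(G,o)}(λ) = P_G^t(o,o)` for all `t ≥ 0`. -/
noncomputable def localSpectralMeasure (o : V) : Measure ℝ :=
  if h : ∃ μ : Measure ℝ, IsLocalSpectralMeasure G o μ then h.choose else 0

open Classical in
/-- The empirical eigenvalue distribution `μ_G = (1/|V|) ∑ᵢ δ_{λᵢ(G)}` of the transition matrix of a
finite graph, the eigenvalues being counted with multiplicity, as the roots of the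
characteristic polynomial (all of which are real). -/
noncomputable def empiricalSpectralMeasure [Fintype V] : Measure ℝ :=
  (Fintype.card V : ℝ≥0∞)⁻¹ •
    ((Matrix.of (transition G)).charpoly.roots.map (fun l => Measure.dirac l)).sum

end Walk

/-! ### Rooted graphs -/

/-- A connected, locally finite rooted graph (such a graph is automatically countable). -/
structure RootedGraph : Type (u + 1) where
  V : Type u
  graph : SimpleGraph V
  root : V
  connected : graph.Connected
  locallyFinite : ∀ x, (graph.neighborSet x).Finite

namespace RootedGraph

/-- Vertex set of the ball of radius `t` around the root. -/
def ball (a : RootedGraph.{u}) (t : ℕ) : Set a.V := {x | a.graph.dist a.root x ≤ t}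

lemma root_mem_ball (a : RootedGraph.{u}) (t : ℕ) : a.root ∈ a.ball t := by
  simp [ball]

/-- Isomorphism of rooted graphs. -/
def Iso (a b : RootedGraph.{u}) : Prop := ∃ φ : a.graph ≃g b.graph, φ a.root = b.root

/-- The balls of radius `t` around the roots, as rooted graphs, are isomorphic. -/
def BallIso (t : ℕ) (a b : RootedGraph.{u}) : Prop :=
  ∃ φ : a.graph.induce (a.ball t) ≃g b.graph.induce (b.ball t),
    φ ⟨a.root, a.root_mem_ball t⟩ = ⟨b.root, b.root_mem_ball t⟩

lemma Iso.refl (a : RootedGraph.{u}) : Iso a a := ⟨SimpleGraph.Iso.refl, rfl⟩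

lemma Iso.symm {a b : RootedGraph.{u}} (h : Iso a b) : Iso b a := by
  obtain ⟨φ, hφ⟩ := h
  exact ⟨φ.symm, by rw [← hφ]; exact φ.symm_apply_apply _⟩

lemma Iso.trans {a b c : RootedGraph.{u}} (h : Iso a b) (h' : Iso b c) : Iso a c := by
  obtain ⟨φ, hφ⟩ := h
  obtain ⟨ψ, hψ⟩ := h'
  exact ⟨φ.trans ψ, by rw [← hψ, ← hφ]; rfl⟩

lemma BallIso.refl (t : ℕ) (a : RootedGraph.{u}) : BallIso t a a := ⟨SimpleGraph.Iso.refl, rfl⟩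

lemma BallIso.symm {t : ℕ} {a b : RootedGraph.{u}} (h : BallIso t a b) : BallIso t b a := by
  obtain ⟨φ, hφ⟩ := h
  exact ⟨φ.symm, by rw [← hφ]; exact φ.symm_apply_apply _⟩

lemma BallIso.trans {t : ℕ} {a b c : RootedGraph.{u}} (h : BallIso t a b) (h' : BallIso t b c) :
    BallIso t a c := by
  obtain ⟨φ, hφ⟩ := h
  obtain ⟨ψ, hψ⟩ := h'
  exact ⟨φ.trans ψ, by rw [← hψ, ← hφ]; rfl⟩

lemma dist_hom_le {a b : RootedGraph.{u}} {t : ℕ}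
    (φ : a.graph.induce (a.ball t) →g b.graph)
    (hφ : φ ⟨a.root, a.root_mem_ball t⟩ = b.root) (x : a.ball t) :
    b.graph.dist b.root (φ x) ≤ a.graph.dist a.root x := by
  classical
  obtain ⟨w, hw⟩ := a.connected.exists_walk_length_eq_dist a.root x
  have hs : ∀ y ∈ w.support, y ∈ a.ball t := by
    intro y hy
    have h1 := SimpleGraph.dist_le (w.takeUntil y hy)
    have h2 := w.length_takeUntil_le_length hy
    have h3 : a.graph.dist a.root x ≤ t := x.2
    change a.graph.dist a.root y ≤ t
    omega
  have h4 := SimpleGraph.dist_le ((w.induce (a.ball t) hs).map φ)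
  have h5 : (w.induce (a.ball t) hs).length = w.length := by
    have h6 := congrArg SimpleGraph.Walk.length (SimpleGraph.Walk.map_induce w hs)
    exact (SimpleGraph.Walk.length_map _ _).symm.trans h6
  rw [SimpleGraph.Walk.length_map, h5, hw, hφ] at h4
  exact h4

/-- A root preserving isomorphism of balls restricts to the smaller balls. -/
lemma BallIso.mono {s t : ℕ} (hst : s ≤ t) {a b : RootedGraph.{u}} (h : BallIso t a b) :
    BallIso s a b := by
  obtain ⟨φ, hφ⟩ := h
  have hφ' : φ.symm ⟨b.root, b.root_mem_ball t⟩ = ⟨a.root, a.root_mem_ball t⟩ := by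
    rw [← hφ]; exact φ.symm_apply_apply _
  have h1 : ∀ x : a.ball t, b.graph.dist b.root (φ x) ≤ a.graph.dist a.root x :=
    dist_hom_le ((SimpleGraph.Embedding.induce _).toHom.comp φ.toHom) (congrArg Subtype.val hφ)
  have h2 : ∀ x : b.ball t, a.graph.dist a.root (φ.symm x) ≤ b.graph.dist b.root x :=
    dist_hom_le ((SimpleGraph.Embedding.induce _).toHom.comp φ.symm.toHom)
      (congrArg Subtype.val hφ')
  have ha : ∀ x ∈ a.ball s, x ∈ a.ball t := fun x hx => le_trans hx hst
  have hb : ∀ x ∈ b.ball s, x ∈ b.ball t := fun x hx => le_trans hx hst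
  refine ⟨⟨⟨fun x => ⟨φ ⟨x, ha x x.2⟩, (h1 ⟨x, ha x x.2⟩).trans x.2⟩,
    fun y => ⟨φ.symm ⟨y, hb y y.2⟩, (h2 ⟨y, hb y y.2⟩).trans y.2⟩, ?_, ?_⟩, ?_⟩, ?_⟩
  · intro x
    apply Subtype.ext
    exact congrArg (fun z : a.ball t => (z : a.V)) (φ.symm_apply_apply ⟨x, ha x x.2⟩)
  · intro y
    apply Subtype.ext
    exact congrArg (fun z : b.ball t => (z : b.V)) (φ.apply_symm_apply ⟨y, hb y y.2⟩)
  · intro x y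
    exact φ.map_rel_iff (a := ⟨x, ha x x.2⟩) (b := ⟨y, ha y y.2⟩)
  · apply Subtype.ext
    exact congrArg (fun z : b.ball t => (z : b.V)) hφ

lemma BallIso.zero (a b : RootedGraph.{u}) : BallIso 0 a b := by
  have h : ∀ (c : RootedGraph.{u}) (x : c.ball 0), x = ⟨c.root, c.root_mem_ball 0⟩ := by
    intro c x
    have hx : c.graph.dist c.root x = 0 := Nat.le_zero.mp x.2
    exact Subtype.ext ((c.connected.dist_eq_zero_iff).mp hx).symm
  refine ⟨⟨⟨fun _ => ⟨b.root, b.root_mem_ball 0⟩, fun _ => ⟨a.root, a.root_mem_ball 0⟩,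
    fun x => (h a x).symm, fun x => (h b x).symm⟩, ?_⟩, rfl⟩
  intro x y
  rw [h a x, h a y]
  simp

lemma Iso.ballIso {a b : RootedGraph.{u}} (h : Iso a b) (t : ℕ) : BallIso t a b := by
  obtain ⟨φ, hφ⟩ := h
  have hφ' : φ.symm b.root = a.root := by rw [← hφ]; exact φ.symm_apply_apply _
  have h1 : ∀ x ∈ a.ball t, φ x ∈ b.ball t := fun x hx =>
    (dist_hom_le (t := t) (φ.toHom.comp (SimpleGraph.Embedding.induce _).toHom) hφ ⟨x, hx⟩).trans hx
  have h2 : ∀ x ∈ b.ball t, φ.symm x ∈ a.ball t := fun x hx =>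
    (dist_hom_le (t := t) (φ.symm.toHom.comp (SimpleGraph.Embedding.induce _).toHom) hφ'
      ⟨x, hx⟩).trans hx
  refine ⟨⟨⟨fun x => ⟨φ x, h1 x x.2⟩, fun x => ⟨φ.symm x, h2 x x.2⟩, ?_, ?_⟩, ?_⟩, ?_⟩
  · intro x
    exact Subtype.ext (φ.symm_apply_apply x)
  · intro x
    exact Subtype.ext (φ.apply_symm_apply x)
  · intro x y
    exact φ.map_rel_iff
  · exact Subtype.ext hφ

/-- Rooted graphs up to isomorphism. -/
instance setoid : Setoid RootedGraph.{u} :=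
  ⟨Iso, ⟨Iso.refl, Iso.symm, Iso.trans⟩⟩

end RootedGraph

lemma transition_iso {V W : Type u} {G : SimpleGraph V} {H : SimpleGraph W} (φ : G ≃g H)
    (x y : V) : transition H (φ x) (φ y) = transition G x y := by
  have h : H.neighborSet (φ x) = φ '' G.neighborSet x := by
    ext z
    constructor
    · intro hz
      refine ⟨φ.symm z, ?_, φ.apply_symm_apply z⟩
      have hz' : H.Adj (φ x) z := hz
      rw [← φ.apply_symm_apply z] at hz'
      exact φ.map_rel_iff.mp hz'
    · rintro ⟨y, hy, rfl⟩
      exact φ.map_rel_iff.mpr hy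
  have hc : (H.neighborSet (φ x)).ncard = (G.neighborSet x).ncard := by
    rw [h, Set.ncard_image_of_injective _ φ.injective]
  have hn : (H.neighborSet (φ x)).Nonempty ↔ (G.neighborSet x).Nonempty := by
    rw [h, Set.image_nonempty]
  have ha : H.Adj (φ x) (φ y) ↔ G.Adj x y := φ.map_rel_iff
  have he : φ x = φ y ↔ x = y := φ.injective.eq_iff
  unfold transition
  rw [hc]
  by_cases h1 : G.Adj x y
  · rw [if_pos h1, if_pos (ha.mpr h1)]
  · rw [if_neg h1, if_neg (mt ha.mp h1)]
    by_cases h2 : x = y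
    · rw [if_pos h2, if_pos (he.mpr h2)]
      by_cases h3 : (G.neighborSet x).Nonempty
      · rw [if_pos h3, if_pos (hn.mpr h3)]
      · rw [if_neg h3, if_neg (mt hn.mp h3)]
    · rw [if_neg h2, if_neg (mt he.mp h2)]

lemma transitionPow_iso {V W : Type u} {G : SimpleGraph V} {H : SimpleGraph W} (φ : G ≃g H)
    (t : ℕ) (x y : V) : transitionPow H t (φ x) (φ y) = transitionPow G t x y := by
  induction t generalizing x with
  | zero =>
    have he : φ x = φ y ↔ x = y := φ.injective.eq_iff
    unfold transitionPow
    by_cases h : x = y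
    · rw [if_pos h, if_pos (he.mpr h)]
    · rw [if_neg h, if_neg (mt he.mp h)]
  | succ t ih =>
    simp only [transitionPow]
    rw [← φ.toEquiv.tsum_eq]
    refine tsum_congr fun z => ?_
    have h1 := transition_iso φ x z
    have h2 := ih z
    exact congrArg₂ (· * ·) h1 h2

/-! ### The space `𝒢_•` of rooted graphs up to isomorphism -/

/-- The space `𝒢_•` of connected, locally finite rooted graphs up to isomorphism. -/
def RootedGraphSpace : Type (u + 1) := Quotient RootedGraph.setoid.{u}

namespace RootedGraphSpace

/-- The isomorphism class of a rooted graph. -/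
def mk (a : RootedGraph.{u}) : RootedGraphSpace.{u} := Quotient.mk _ a

/-- `ℬ_t(G,o) ≃ ℬ_t(G',o')`. -/
def SameBall (t : ℕ) (g h : RootedGraphSpace.{u}) : Prop :=
  Quotient.liftOn₂ g h (RootedGraph.BallIso t) fun _ _ _ _ h₁ h₂ => propext
    ⟨fun h => ((RootedGraph.Iso.ballIso h₁ t).symm.trans h).trans (RootedGraph.Iso.ballIso h₂ t),
      fun h => ((RootedGraph.Iso.ballIso h₁ t).trans h).trans
        (RootedGraph.Iso.ballIso h₂ t).symm⟩

/-- `r = sup {t ≥ 0 : ℬ_t(G,o) ≃ ℬ_t(G',o')}`, in `ℕ ∪ {∞}`. -/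
noncomputable def agreementRadius (g h : RootedGraphSpace.{u}) : ℕ∞ :=
  ⨆ (t : ℕ) (_ : SameBall t g h), (t : ℕ∞)

lemma sameBall_refl (t : ℕ) (g : RootedGraphSpace.{u}) : SameBall t g g := by
  induction g using Quotient.inductionOn with
  | h a => exact RootedGraph.BallIso.refl t a

lemma SameBall.symm {t : ℕ} {g h : RootedGraphSpace.{u}} (H : SameBall t g h) :
    SameBall t h g := by
  induction g using Quotient.inductionOn
  induction h using Quotient.inductionOn
  exact RootedGraph.BallIso.symm H

lemma SameBall.trans {t : ℕ} {g h k : RootedGraphSpace.{u}} (H : SameBall t g h)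
    (H' : SameBall t h k) : SameBall t g k := by
  induction g using Quotient.inductionOn
  induction h using Quotient.inductionOn
  induction k using Quotient.inductionOn
  exact RootedGraph.BallIso.trans H H'

lemma SameBall.mono {s t : ℕ} (hst : s ≤ t) {g h : RootedGraphSpace.{u}} (H : SameBall t g h) :
    SameBall s g h := by
  induction g using Quotient.inductionOn
  induction h using Quotient.inductionOn
  exact RootedGraph.BallIso.mono hst H

lemma sameBall_zero (g h : RootedGraphSpace.{u}) : SameBall 0 g h := by
  induction g using Quotient.inductionOn
  induction h using Quotient.inductionOn
  exact RootedGraph.BallIso.zero _ _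

lemma le_agreementRadius_iff {t : ℕ} {g h : RootedGraphSpace.{u}} :
    (t : ℕ∞) ≤ agreementRadius g h ↔ SameBall t g h := by
  constructor
  · intro H
    by_contra hn
    cases t with
    | zero => exact hn (sameBall_zero g h)
    | succ t =>
      have : agreementRadius g h ≤ (t : ℕ∞) := by
        refine iSup₂_le fun s hs => ?_
        by_contra hlt
        have hlt' : t < s := by
          by_contra hh
          exact hlt (by exact_mod_cast not_lt.mp hh)
        exact hn (hs.mono hlt')
      have h2 := H.trans this
      have h3 : t + 1 ≤ t := by exact_mod_cast h2
      omega
  · intro H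
    exact le_iSup₂_of_le t H le_rfl

/-- The local metric `1 / (1 + r)`, equal to `0` when `r = ∞`. -/
noncomputable def localDist (g h : RootedGraphSpace.{u}) : ℝ :=
  ((1 + (agreementRadius g h : ℝ≥0∞))⁻¹).toReal

lemma localDist_self (g : RootedGraphSpace.{u}) : localDist g g = 0 := by
  have : agreementRadius g g = ⊤ := by
    refine top_le_iff.mp (ENat.forall_natCast_le_iff_le.mp fun t _ => ?_)
    exact le_agreementRadius_iff.mpr (sameBall_refl t g)
  simp [localDist, this]

lemma localDist_comm (g h : RootedGraphSpace.{u}) : localDist g h = localDist h g := by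
  have : agreementRadius g h = agreementRadius h g := by
    refine le_antisymm ?_ ?_ <;> refine ENat.forall_natCast_le_iff_le.mp fun t ht => ?_ <;>
      exact le_agreementRadius_iff.mpr (le_agreementRadius_iff.mp ht).symm
  simp [localDist, this]

lemma localDist_nonneg (g h : RootedGraphSpace.{u}) : 0 ≤ localDist g h := ENNReal.toReal_nonneg

lemma localDist_le_of_le {g h g' h' : RootedGraphSpace.{u}}
    (H : agreementRadius g h ≤ agreementRadius g' h') : localDist g' h' ≤ localDist g h := by
  refine ENNReal.toReal_mono ?_ ?_
  · exact ENNReal.inv_ne_top.mpr (by simp)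
  · have : (agreementRadius g h : ℝ≥0∞) ≤ (agreementRadius g' h' : ℝ≥0∞) := by
      exact_mod_cast H
    gcongr

lemma localDist_triangle (g h k : RootedGraphSpace.{u}) :
    localDist g k ≤ localDist g h + localDist h k := by
  have key : min (agreementRadius g h) (agreementRadius h k) ≤ agreementRadius g k := by
    refine ENat.forall_natCast_le_iff_le.mp fun t ht => ?_
    rw [le_min_iff] at ht
    exact le_agreementRadius_iff.mpr
      ((le_agreementRadius_iff.mp ht.1).trans (le_agreementRadius_iff.mp ht.2))
  rcases min_le_iff.mp key with H | H
  · exact (localDist_le_of_le H).trans (le_add_of_nonneg_right (localDist_nonneg _ _))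
  · exact (localDist_le_of_le H).trans (le_add_of_nonneg_left (localDist_nonneg _ _))

/-- The local metric on `𝒢_•`. (That points at distance zero coincide plays no role in the
definition of the topology, so it is not recorded here.) -/
noncomputable instance : PseudoMetricSpace RootedGraphSpace.{u} where
  dist := localDist
  dist_self := localDist_self
  dist_comm := localDist_comm
  dist_triangle := localDist_triangle

noncomputable instance : MeasurableSpace RootedGraphSpace.{u} := borel _

instance : BorelSpace RootedGraphSpace.{u} := ⟨rfl⟩

/-- The return probability `P_G^t(o,o)`, as a function on `𝒢_•`. -/
noncomputable def returnProb (t : ℕ) (g : RootedGraphSpace.{u}) : ℝ :=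
  Quotient.liftOn g (fun a => transitionPow a.graph t a.root a.root) (by
    rintro a b ⟨φ, hφ⟩
    rw [← hφ, transitionPow_iso])

/-- The spectral radius `lim_t (P_G^t(o,o))^(1/t)`. The limit exists, by supermultiplicativity of
the return probabilities. -/
noncomputable def spectralRadius (g : RootedGraphSpace.{u}) : ℝ :=
  limUnder atTop fun t : ℕ => returnProb t g ^ (1 / (t : ℝ))

end RootedGraphSpace

/-! ### Local weak convergence -/

section LocalProfile

variable {V : Type u} [Fintype V] (G : SimpleGraph V)

/-- The connected component of `x` in a finite graph `G`, rooted at `x`. -/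
def componentAt (x : V) : RootedGraph.{u} where
  V := G.connectedComponentMk x
  graph := (G.connectedComponentMk x).toSimpleGraph
  root := ⟨x, rfl⟩
  connected := (G.connectedComponentMk x).connected_toSimpleGraph
  locallyFinite := fun _ => Set.toFinite _

/-- The local profile `ℒ_G = (1/|V|) ∑_x δ_{(G,x)}` of a finite nonempty graph. -/
noncomputable def localProfile [Nonempty V] : ProbabilityMeasure RootedGraphSpace.{u} :=
  ⟨(Fintype.card V : ℝ≥0∞)⁻¹ • ∑ x : V, Measure.dirac (RootedGraphSpace.mk (componentAt G x)), ⟨by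
    simp only [Measure.smul_apply, Measure.finsetSum_apply, measure_univ, Finset.sum_const,
      Finset.card_univ, nsmul_eq_mul, mul_one, smul_eq_mul]
    exact ENNReal.inv_mul_cancel (by simp) (by simp)⟩⟩

end LocalProfile

/-! ### Transition probabilities of the lazy walk -/

section Walk

variable {V : Type u} {G : SimpleGraph V}

/-! Spectral information is read off from return probabilities. Since `l ^ t ≤ r ^ t + 1` on `[r,
1]` and `l ^ t ≤ r ^ t` on `[0, r)`, a spectral measure whose `t`-th moment exceeds `2 * r ^ t`
gives mass more than `r ^ t` to `[r, 1]` (`IsLocalSpectralMeasure.sub_pow_le`, and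
`ofReal_average_sub_pow_le` for the average over vertices).

The return probability at time `t` depends only on the ball of radius `t`, so it is locally constant
on `𝒢_•`. Where the spectral radius is 1, it exceeds `2 * r ^ t` for all large `t`; hence one
deterministic `t` works with limit probability arbitrarily close to 1. This event is open, so by the
portmanteau theorem it holds at nearly all vertices of `G n` for large `n`
(`exists_eventually_lt_ncard`). This settles the first claim, and the second for large `n`.

The supremum also involves finitely many small `n`. There every vertex has positive mass in `[r,
1]`, because on a finite graph even-time return probabilities are bounded below uniformly in time
(`inv_card_pow_le_transitionPow`). -/

lemma transition_of_adj {x y : V} (h : G.Adj x y) :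
    transition G x y = 1 / (2 * ((G.neighborSet x).ncard : ℝ)) := if_pos h

lemma transition_of_ne {x y : V} (h : ¬ G.Adj x y) (hne : x ≠ y) : transition G x y = 0 := by
  rw [transition, if_neg h, if_neg hne]

lemma half_le_transition_self (x : V) : 1 / 2 ≤ transition G x x := by
  rw [transition, if_neg (G.loopless.irrefl x), if_pos rfl]
  split_ifs <;> norm_num

lemma transition_nonneg (x y : V) : 0 ≤ transition G x y := by
  unfold transition
  split_ifs <;> positivity

lemma support_transition_subset (x : V) :
    Function.support (transition G x) ⊆ insert x (G.neighborSet x) := by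
  intro y hy
  by_contra h
  rw [Set.mem_insert_iff, not_or] at h
  exact hy (transition_of_ne h.2 (Ne.symm h.1))

lemma summable_transition_mul {x : V} (hx : (G.neighborSet x).Finite) (f : V → ℝ) :
    Summable fun z => transition G x z * f z :=
  summable_of_hasFiniteSupport (((hx.insert x).subset (support_transition_subset x)).subset
    (Function.support_mul_subset_left _ _))

lemma hasSum_transition {x : V} (hx : (G.neighborSet x).Finite) :
    HasSum (transition G x) 1 := by
  classical
  have hs : ∀ y ∉ insert x hx.toFinset, transition G x y = 0 := by
    intro y hy
    by_contra h
    exact hy (by simpa using support_transition_subset x h)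
  have key : HasSum (transition G x) _ := hasSum_sum_of_ne_finset_zero hs
  convert key using 1
  have hxn : x ∉ hx.toFinset := by simp
  rw [Finset.sum_insert hxn, Finset.sum_congr rfl (g := fun _ =>
    1 / (2 * ((G.neighborSet x).ncard : ℝ)))
    (fun y hy => transition_of_adj (by simpa using hy)), Finset.sum_const,
    ← Set.ncard_eq_toFinset_card _ hx, transition, if_neg (G.loopless.irrefl x), if_pos rfl]
  split_ifs with h
  · have : (0 : ℝ) < (G.neighborSet x).ncard := by
      exact_mod_cast (Set.ncard_pos hx).mpr h
    rw [nsmul_eq_mul]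
    field_simp
    norm_num
  · rw [Set.not_nonempty_iff_eq_empty.mp h]
    simp

lemma transitionPow_succ (t : ℕ) (x y : V) :
    transitionPow G (t + 1) x y = ∑' z, transition G x z * transitionPow G t z y := rfl

lemma transitionPow_nonneg (t : ℕ) (x y : V) : 0 ≤ transitionPow G t x y := by
  induction t generalizing x with
  | zero => unfold transitionPow; split_ifs <;> norm_num
  | succ t ih => exact tsum_nonneg fun z => mul_nonneg (transition_nonneg _ _) (ih z)

lemma transitionPow_le_one (hG : ∀ x, (G.neighborSet x).Finite) (t : ℕ) (x y : V) :
    transitionPow G t x y ≤ 1 := by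
  induction t generalizing x with
  | zero => unfold transitionPow; split_ifs <;> norm_num
  | succ t ih =>
    rw [transitionPow_succ, ← (hasSum_transition (hG x)).tsum_eq]
    exact (summable_transition_mul (hG x) _).tsum_le_tsum
      (fun z => mul_le_of_le_one_right (transition_nonneg _ _) (ih z))
      (hasSum_transition (hG x)).summable

/-- Chapman–Kolmogorov with a single intermediate state kept. With `x = y = z` it is the
supermultiplicativity behind the spectral radius. -/
lemma transitionPow_mul_le (hG : ∀ x, (G.neighborSet x).Finite) (s t : ℕ) (x y z : V) :
    transitionPow G s x z * transitionPow G t z y ≤ transitionPow G (s + t) x y := by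
  induction s generalizing x with
  | zero =>
    rw [zero_add]
    by_cases h : x = z
    · subst h
      simp [transitionPow]
    · simpa [transitionPow, h] using transitionPow_nonneg t x y
  | succ s ih =>
    rw [show s + 1 + t = (s + t) + 1 by ring, transitionPow_succ, transitionPow_succ,
      ← tsum_mul_right]
    refine Summable.tsum_le_tsum (fun w => ?_)
      ((summable_transition_mul (hG x) _).mul_right _) (summable_transition_mul (hG x) _)
    rw [mul_assoc]
    exact mul_le_mul_of_nonneg_left (ih w) (transition_nonneg _ _)

lemma transitionPow_self_pos (hG : ∀ x, (G.neighborSet x).Finite) (t : ℕ) (x : V) :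
    0 < transitionPow G t x x := by
  induction t with
  | zero => simp [transitionPow]
  | succ t ih =>
    refine lt_of_lt_of_le (mul_pos (lt_of_lt_of_le (by norm_num) (half_le_transition_self (G := G) x)) ih)
      ?_
    exact (summable_transition_mul (hG x) fun z => transitionPow G t z x).le_tsum x
      fun z _ => mul_nonneg (transition_nonneg _ _) (transitionPow_nonneg _ _ _)

/-- Transition probabilities along an embedding `f` agree from points out of which the walk cannot
leave the range of `f`; `D t x` expresses that this is so for `t` steps from `x`. -/
lemma transitionPow_of_injective {W : Type u} {H : SimpleGraph W} {f : W → V}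
    (hf : Function.Injective f) (hadj : ∀ x y, G.Adj (f x) (f y) ↔ H.Adj x y) (D : ℕ → W → Prop)
    (hD : ∀ t x, D (t + 1) x → G.neighborSet (f x) ⊆ Set.range f)
    (hD0 : ∀ t x, D (t + 1) x → D t x)
    (hD1 : ∀ t x y, D (t + 1) x → H.Adj x y → D t y) (t : ℕ) (x y : W) (hx : D t x) :
    transitionPow G t (f x) (f y) = transitionPow H t x y := by
  classical
  induction t generalizing x with
  | zero => simp [transitionPow, hf.eq_iff]
  | succ t ih =>
    have himg : G.neighborSet (f x) = f '' H.neighborSet x := by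
      ext v
      constructor
      · intro hv
        obtain ⟨z, rfl⟩ := hD t x hx hv
        exact ⟨z, (hadj x z).mp hv, rfl⟩
      · rintro ⟨z, hz, rfl⟩
        exact (hadj x z).mpr hz
    have htr : ∀ z, transition G (f x) (f z) = transition H x z := by
      intro z
      unfold transition
      rw [himg, Set.ncard_image_of_injective _ hf, Set.image_nonempty]
      simp only [hadj, hf.eq_iff]
    -- The sum over `V` reduces to the range of `f`, which contains every point reachable in one
    -- step from `f x`.
    rw [transitionPow_succ, transitionPow_succ, ← hf.tsum_eq]
    · refine tsum_congr fun z => ?_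
      rw [htr]
      by_cases hz : H.Adj x z
      · rw [ih z (hD1 t x z hx hz)]
      · by_cases hxz : x = z
        · subst hxz
          rw [ih x (hD0 t x hx)]
        · rw [transition_of_ne hz hxz, zero_mul, zero_mul]
    · refine (Function.support_mul_subset_left _ _).trans
        ((support_transition_subset _).trans ?_)
      exact Set.insert_subset ⟨x, rfl⟩ (hD t x hx)

end Walk

/-! ### Return probabilities on `𝒢_•` -/

namespace RootedGraph

/-- With `s` steps left, the walk is within distance `t - s` of the root. Vertices on the boundary,
whose degree may drop in the ball, are reached only when no step remains. -/
lemma transitionPow_ball (a : RootedGraph.{u}) (t : ℕ) :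
    transitionPow (a.graph.induce (a.ball t)) t ⟨a.root, a.root_mem_ball t⟩
      ⟨a.root, a.root_mem_ball t⟩ = transitionPow a.graph t a.root a.root := by
  have hstep : ∀ x y, a.graph.Adj x y → a.graph.dist a.root y ≤ a.graph.dist a.root x + 1 := by
    intro x y h
    have h1 := a.connected.dist_triangle (u := a.root) (v := x) (w := y)
    rwa [SimpleGraph.dist_eq_one_iff_adj.mpr h] at h1
  refine (transitionPow_of_injective (f := Subtype.val) Subtype.val_injective
    (fun x y => Iff.rfl) (fun s x => a.graph.dist a.root x + s ≤ t) ?_ ?_ ?_ t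
    ⟨a.root, a.root_mem_ball t⟩ ⟨a.root, a.root_mem_ball t⟩ ?_).symm
  · intro s x hx y hy
    have := hstep x y hy
    exact ⟨⟨y, by change a.graph.dist a.root y ≤ t; omega⟩, rfl⟩
  · intro s x hx
    omega
  · intro s x y hx hxy
    have := hstep x y hxy
    omega
  · simp

end RootedGraph

namespace RootedGraphSpace

lemma SameBall.returnProb_eq {t : ℕ} {g h : RootedGraphSpace.{u}} (H : SameBall t g h) :
    returnProb t g = returnProb t h := by
  induction g using Quotient.inductionOn
  induction h using Quotient.inductionOn
  rename_i a b
  obtain ⟨φ, hφ⟩ := H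
  change transitionPow a.graph t a.root a.root = transitionPow b.graph t b.root b.root
  rw [← a.transitionPow_ball, ← b.transitionPow_ball, ← hφ, transitionPow_iso]

lemma sameBall_of_dist_lt {t : ℕ} {g h : RootedGraphSpace.{u}} (H : dist g h < 1 / (1 + (t : ℝ))) :
    SameBall t g h := by
  by_contra hn
  have h1 : agreementRadius g h ≤ (t : ℕ∞) := by
    by_contra hlt
    exact hn (le_agreementRadius_iff.mp (not_le.mp hlt).le)
  have h2 : ((1 + (t : ℝ≥0∞))⁻¹).toReal ≤ dist g h := by
    refine ENNReal.toReal_mono (ENNReal.inv_ne_top.mpr (by simp)) ?_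
    have : (agreementRadius g h : ℝ≥0∞) ≤ (((t : ℕ∞)) : ℝ≥0∞) := by
      exact_mod_cast h1
    gcongr
    simpa using this
  rw [ENNReal.toReal_inv, ENNReal.toReal_add (by simp) (by simp)] at h2
  simp only [ENNReal.toReal_one, ENNReal.toReal_natCast] at h2
  rw [one_div] at H
  exact absurd H (not_lt.mpr h2)

/-- The return probability is constant on balls of radius `1 / (1 + t)`, so `s` may be arbitrary. -/
lemma isOpen_returnProb (t : ℕ) (s : Set ℝ) :
    IsOpen {g : RootedGraphSpace.{u} | returnProb t g ∈ s} := by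
  rw [Metric.isOpen_iff]
  intro g hg
  refine ⟨1 / (1 + (t : ℝ)), by positivity, fun h hh => ?_⟩
  change returnProb t h ∈ s
  rw [(sameBall_of_dist_lt hh).returnProb_eq]
  exact hg

lemma returnProb_pos (t : ℕ) (g : RootedGraphSpace.{u}) : 0 < returnProb t g := by
  induction g using Quotient.inductionOn with
  | h a => exact transitionPow_self_pos a.locallyFinite t a.root

lemma returnProb_le_one (t : ℕ) (g : RootedGraphSpace.{u}) : returnProb t g ≤ 1 := by
  induction g using Quotient.inductionOn with
  | h a => exact transitionPow_le_one a.locallyFinite t a.root a.root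

lemma returnProb_mul_le (s t : ℕ) (g : RootedGraphSpace.{u}) :
    returnProb s g * returnProb t g ≤ returnProb (s + t) g := by
  induction g using Quotient.inductionOn with
  | h a => exact transitionPow_mul_le a.locallyFinite s t a.root a.root a.root

/-- Fekete's lemma for minus the logarithm of the return probability. It ensures that the `limUnder`
defining `spectralRadius` is a genuine limit. -/
lemma tendsto_spectralRadius (g : RootedGraphSpace.{u}) :
    Tendsto (fun t : ℕ => returnProb t g ^ (1 / (t : ℝ))) atTop (𝓝 (spectralRadius g)) := by
  have hsub : Subadditive fun t => -Real.log (returnProb t g) := by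
    intro s t
    have h := Real.log_le_log (mul_pos (returnProb_pos s g) (returnProb_pos t g))
      (returnProb_mul_le s t g)
    rw [Real.log_mul (returnProb_pos s g).ne' (returnProb_pos t g).ne'] at h
    linarith
  have hbdd : BddBelow (Set.range fun t : ℕ => -Real.log (returnProb t g) / t) := by
    refine ⟨0, ?_⟩
    rintro _ ⟨t, rfl⟩
    exact div_nonneg (neg_nonneg.mpr
      (Real.log_nonpos (returnProb_pos t g).le (returnProb_le_one t g))) (Nat.cast_nonneg t)
  have h := (Real.continuous_exp.tendsto _).comp (hsub.tendsto_lim hbdd).neg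
  refine tendsto_nhds_limUnder ⟨_, h.congr fun t => ?_⟩
  rw [Function.comp_apply, Real.rpow_def_of_pos (returnProb_pos t g)]
  congr 1
  ring

/-- For `q` strictly between `r` and 1, the return probability eventually exceeds `q ^ t`, and `(q /
r) ^ t` eventually exceeds 2. The factor 2 leaves a margin `r ^ t` once `r ^ t` is subtracted. -/
lemma eventually_lt_returnProb {g : RootedGraphSpace.{u}} (hg : spectralRadius g = 1) {r : ℝ}
    (hr0 : 0 < r) (hr1 : r < 1) : ∀ᶠ t : ℕ in atTop, 2 * r ^ t < returnProb t g := by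
  obtain ⟨q, hq, hq1⟩ := exists_between hr1
  have h1 := (tendsto_spectralRadius g).eventually_const_lt (hg ▸ hq1)
  have h2 := (tendsto_pow_atTop_atTop_of_one_lt ((one_lt_div hr0).mpr hq)).eventually_gt_atTop 2
  filter_upwards [h1, h2, eventually_gt_atTop 0] with t h1 h2 ht
  rw [div_pow, lt_div_iff₀ (pow_pos hr0 t)] at h2
  refine h2.trans ?_
  have h3 := pow_lt_pow_left₀ h1 (hr0.trans hq).le ht.ne'
  rwa [← Real.rpow_natCast (_ ^ _), ← Real.rpow_mul (returnProb_pos t g).le,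
    one_div_mul_cancel (by exact_mod_cast ht.ne'), Real.rpow_one] at h3

/-- The walk never leaves its component, so the number of remaining steps imposes no condition. -/
lemma returnProb_componentAt {V : Type u} [Fintype V] (G : SimpleGraph V) (t : ℕ) (x : V) :
    returnProb t (mk (componentAt G x)) = transitionPow G t x x := by
  refine (transitionPow_of_injective (G := G)
    (H := (G.connectedComponentMk x).toSimpleGraph) (f := Subtype.val) Subtype.val_injective
    (fun y z => Iff.rfl) (fun _ _ => True) ?_ (fun _ _ _ => trivial) (fun _ _ _ _ _ => trivial) t
    ⟨x, rfl⟩ ⟨x, rfl⟩ trivial).symm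
  intro _ y _ z hz
  have hz' : G.Adj y z := hz
  refine ⟨⟨z, ?_⟩, rfl⟩
  have hy : G.connectedComponentMk y = G.connectedComponentMk x := y.2
  change G.connectedComponentMk z = G.connectedComponentMk x
  rw [← hy]
  exact SimpleGraph.ConnectedComponent.sound hz'.symm.reachable

end RootedGraphSpace

/-! ### Spectral decomposition on finite graphs -/

section SpectralDecomposition

/-- Diagonalization of a real matrix which is reversible with respect to the positive weights
`w`. -/
lemma Matrix.exists_spectral_decomposition_of_reversible {n : Type*} [Fintype n] [DecidableEq n]
    (A : Matrix n n ℝ) (w : n → ℝ) (hw : ∀ x, 0 < w x) (hA : ∀ x y, w x * A x y = w y * A y x) :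
    ∃ (l : n → ℝ) (c : n → n → ℝ), (∀ x i, 0 ≤ c x i) ∧ (∀ x, ∑ i, c x i = 1) ∧
      (∀ i, ∑ x, c x i = 1) ∧ (∀ (t : ℕ) (x : n), (A ^ t) x x = ∑ i, l i ^ t * c x i) ∧
      A.charpoly.roots = Multiset.map l Finset.univ.val := by
  -- Conjugating by the square roots of the weights makes `A` symmetric, without changing the
  -- diagonal entries of its powers or its characteristic polynomial.
  set D : Matrix n n ℝ := Matrix.diagonal fun x => √(w x) with hD
  set D' : Matrix n n ℝ := Matrix.diagonal fun x => (√(w x))⁻¹ with hD'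
  have hs : ∀ x, 0 < √(w x) := fun x => Real.sqrt_pos.mpr (hw x)
  have hDD' : D' * D = 1 := by
    rw [hD, hD', Matrix.diagonal_mul_diagonal, ← Matrix.diagonal_one]
    congr 1
    funext x
    exact inv_mul_cancel₀ (hs x).ne'
  have hent : ∀ (B : Matrix n n ℝ) (x y : n), (D * B * D') x y = √(w x) * B x y * (√(w y))⁻¹ := by
    intro B x y
    rw [hD', Matrix.mul_diagonal, hD, Matrix.diagonal_mul]
  have hS : (D * A * D').IsHermitian := by
    refine Matrix.IsHermitian.ext fun x y => ?_
    rw [star_trivial, hent, hent]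
    have h1 := Real.mul_self_sqrt (hw x).le
    have h2 := Real.mul_self_sqrt (hw y).le
    have h3 := hA x y
    have := (hs x).ne'
    have := (hs y).ne'
    rw [← h1, ← h2] at h3
    field_simp
    linarith
  have hpow : ∀ t : ℕ, (D * A * D') ^ t = D * A ^ t * D' := by
    intro t
    induction t with
    | zero => rw [pow_zero, pow_zero, mul_one, mul_eq_one_comm.mp hDD']
    | succ t ih =>
      calc (D * A * D') ^ (t + 1) = D * A ^ t * (D' * D) * A * D' := by
            rw [pow_succ, ih]; simp only [mul_assoc]
        _ = D * A ^ (t + 1) * D' := by rw [hDD', mul_one, mul_assoc D, ← pow_succ]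
  set U : Matrix n n ℝ := (hS.eigenvectorUnitary : Matrix n n ℝ) with hU
  have hUU : U * star U = 1 := Unitary.coe_mul_star_self _
  have hUU' : star U * U = 1 := Unitary.coe_star_mul_self _
  have hspec : D * A * D' = U * Matrix.diagonal hS.eigenvalues * star U := by
    have := hS.spectral_theorem
    rw [Unitary.conjStarAlgAut_apply] at this
    exact this
  have hpow' : ∀ t : ℕ, (D * A * D') ^ t =
      U * Matrix.diagonal (hS.eigenvalues ^ t) * star U := by
    intro t
    rw [← Matrix.diagonal_pow]
    induction t with
    | zero => rw [pow_zero, pow_zero, mul_one, hUU]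
    | succ t ih =>
      calc (D * A * D') ^ (t + 1)
          = U * Matrix.diagonal hS.eigenvalues ^ t * (star U * U) *
            Matrix.diagonal hS.eigenvalues * star U := by
            rw [pow_succ, ih, show ∀ M : Matrix n n ℝ, M * (D * A * D') =
              M * (U * Matrix.diagonal hS.eigenvalues * star U) from fun M => congrArg (M * ·) hspec]
            simp only [mul_assoc]
        _ = _ := by rw [hUU', mul_one, mul_assoc U, ← pow_succ]
  -- Squared entries of an orthogonal matrix are doubly stochastic: row sums give probability
  -- measures at each vertex, column sums give the trace.
  refine ⟨hS.eigenvalues, fun x i => U x i ^ 2, fun x i => sq_nonneg _, fun x => ?_, fun i => ?_,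
    fun t x => ?_, ?_⟩
  · have := congrFun (congrFun hUU x) x
    rw [Matrix.mul_apply, Matrix.one_apply_eq] at this
    rw [← this]
    exact Finset.sum_congr rfl fun i _ => sq _
  · have := congrFun (congrFun hUU' i) i
    rw [Matrix.mul_apply, Matrix.one_apply_eq] at this
    rw [← this]
    exact Finset.sum_congr rfl fun x _ => sq _
  · have h1 : ((D * A * D') ^ t) x x = (A ^ t) x x := by
      rw [hpow, hent]
      have := (hs x).ne'
      field_simp
    rw [← h1, hpow', Matrix.mul_apply]
    refine Finset.sum_congr rfl fun i _ => ?_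
    rw [Matrix.mul_diagonal, Pi.pow_apply]
    change U x i * _ * U x i = _
    ring
  · have h1 : A.charpoly = (D * A * D').charpoly := by
      rw [Matrix.charpoly_mul_comm, ← mul_assoc, hDD', one_mul]
    rw [h1, hS.roots_charpoly_eq_eigenvalues]
    rfl

variable {V : Type u} (G : SimpleGraph V)

/-- Reversing weights for the lazy walk: the degree, or `1` at isolated vertices. -/
noncomputable def walkWeight (x : V) : ℝ := max ((G.neighborSet x).ncard : ℝ) 1

lemma one_le_walkWeight (x : V) : 1 ≤ walkWeight G x := le_max_right _ _

variable [Fintype V]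

lemma walkWeight_le_card (x : V) : walkWeight G x ≤ Fintype.card V := by
  refine max_le ?_ ?_
  · rw [← Nat.card_eq_fintype_card]
    exact_mod_cast Set.ncard_le_card _
  · exact_mod_cast Fintype.card_pos_iff.mpr ⟨x⟩

lemma walkWeight_mul_transition (x y : V) :
    walkWeight G x * transition G x y = walkWeight G y * transition G y x := by
  have key : ∀ a b : V, G.Adj a b → walkWeight G a * transition G a b = 1 / 2 := by
    intro a b h
    have h1 : 1 ≤ (G.neighborSet a).ncard :=
      (Set.ncard_pos (Set.toFinite _)).mpr ⟨b, h⟩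
    have h2 : (1 : ℝ) ≤ (G.neighborSet a).ncard := by exact_mod_cast h1
    rw [transition_of_adj h, walkWeight, max_eq_left h2]
    field_simp
  by_cases h : G.Adj x y
  · rw [key x y h, key y x h.symm]
  · by_cases hxy : x = y
    · rw [hxy]
    · rw [transition_of_ne h hxy, transition_of_ne (fun h' => h h'.symm) (Ne.symm hxy),
        mul_zero, mul_zero]

open Classical in
lemma transitionMatrix_pow (t : ℕ) (x y : V) :
    (Matrix.of (transition G) ^ t) x y = transitionPow G t x y := by
  induction t generalizing x with
  | zero => rw [pow_zero, Matrix.one_apply, transitionPow]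
  | succ t ih =>
    rw [pow_succ', Matrix.mul_apply, transitionPow_succ, tsum_fintype]
    exact Finset.sum_congr rfl fun z _ => by rw [ih, Matrix.of_apply]

open Classical in
-- Gershgorin: the disc of row `k` has centre `p = transition G k k` and radius `1 - p`, and
-- laziness gives `p ≥ 1 / 2`, so it lies in `[2 * p - 1, 1]`.
lemma mem_Icc_of_isRoot_charpoly {r : ℝ} (hr : (Matrix.of (transition G)).charpoly.IsRoot r) :
    r ∈ Set.Icc (0 : ℝ) 1 := by
  have hev : Module.End.HasEigenvalue (Matrix.toLin' (Matrix.of (transition G))) r := by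
    rw [Module.End.hasEigenvalue_iff_isRoot_charpoly, Matrix.charpoly_toLin']
    exact hr
  obtain ⟨k, hk⟩ := eigenvalue_mem_ball hev
  have hsum : ∑ j ∈ Finset.univ.erase k, ‖Matrix.of (transition G) k j‖ =
      1 - transition G k k := by
    have h1 := (hasSum_transition (G := G) (Set.toFinite (G.neighborSet k))).tsum_eq
    rw [tsum_fintype, ← Finset.add_sum_erase _ _ (Finset.mem_univ k)] at h1
    rw [← h1, add_sub_cancel_left]
    exact Finset.sum_congr rfl fun j _ => Real.norm_of_nonneg (transition_nonneg _ _)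
  rw [hsum, Metric.mem_closedBall, Real.dist_eq, abs_le, Matrix.of_apply] at hk
  have := half_le_transition_self (G := G) k
  constructor <;> linarith [hk.1, hk.2]

/-- Eigenvalues `l` of the walk, with the masses `c x i` that the spectral measure at `x` gives
them. -/
lemma exists_spectral_decomposition : ∃ (l : V → ℝ) (c : V → V → ℝ),
    (∀ i, l i ∈ Set.Icc (0 : ℝ) 1) ∧ (∀ x i, 0 ≤ c x i) ∧ (∀ x, ∑ i, c x i = 1) ∧
      (∀ i, ∑ x, c x i = 1) ∧ (∀ (t : ℕ) (x : V), transitionPow G t x x = ∑ i, l i ^ t * c x i) ∧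
      ∀ s : Set ℝ, MeasurableSet s → empiricalSpectralMeasure G s =
        (Fintype.card V : ℝ≥0∞)⁻¹ * ∑ i, s.indicator 1 (l i) := by
  classical
  obtain ⟨l, c, h0, h1, h2, h3, h4⟩ := Matrix.exists_spectral_decomposition_of_reversible
    (Matrix.of (transition G)) (walkWeight G)
    (fun x => zero_lt_one.trans_le (one_le_walkWeight G x)) (walkWeight_mul_transition G)
  refine ⟨l, c, fun i => ?_, h0, h1, h2, fun t x => ?_, fun s hs => ?_⟩
  · refine mem_Icc_of_isRoot_charpoly G (Polynomial.isRoot_of_mem_roots ?_)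
    convert Multiset.mem_map_of_mem l (Finset.mem_univ_val i)
  · rw [← h3, ← transitionMatrix_pow]
  · have h5 : ((Matrix.of (transition G)).charpoly.roots.map fun l => Measure.dirac l).sum =
        ∑ i, Measure.dirac (l i) := by
      rw [h4, Multiset.map_map]
      rfl
    have h6 : empiricalSpectralMeasure G = (Fintype.card V : ℝ≥0∞)⁻¹ •
        ((Matrix.of (transition G)).charpoly.roots.map fun l => Measure.dirac l).sum := by
      unfold empiricalSpectralMeasure
      congr!
    rw [h6, h5, Measure.smul_apply, Measure.finsetSum_apply, smul_eq_mul]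
    simp only [Measure.dirac_apply' _ hs]

/-- Atoms of mass `c x i` at the eigenvalues `l i` form a witness, so the default value 0 is not
taken. Uniqueness is not needed: later arguments use only the defining properties. -/
lemma isLocalSpectralMeasure_localSpectralMeasure (x : V) :
    IsLocalSpectralMeasure G x (localSpectralMeasure G x) := by
  suffices h : ∃ μ : Measure ℝ, IsLocalSpectralMeasure G x μ by
    rw [localSpectralMeasure, dif_pos h]
    exact h.choose_spec
  obtain ⟨l, c, hl, h0, h1, -, h3, -⟩ := exists_spectral_decomposition G
  have hmass : ∑ i, ENNReal.ofReal (c x i) = 1 := by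
    rw [← ENNReal.ofReal_sum_of_nonneg fun i _ => h0 x i, h1, ENNReal.ofReal_one]
  refine ⟨∑ i, ENNReal.ofReal (c x i) • Measure.dirac (l i), ⟨?_⟩, ?_, fun t => ?_⟩
  · simpa [Measure.finsetSum_apply] using hmass
  · rw [Measure.finsetSum_apply, ← hmass]
    refine Finset.sum_congr rfl fun i _ => ?_
    rw [Measure.smul_apply, Measure.dirac_apply' _ measurableSet_Icc,
      Set.indicator_of_mem (hl i)]
    simp
  · rw [integral_finsetSum_measure, h3]
    · refine Finset.sum_congr rfl fun i _ => ?_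
      rw [integral_smul_measure, integral_dirac, ENNReal.toReal_ofReal (h0 x i), smul_eq_mul,
        mul_comm]
    · intro i _
      exact (integrable_dirac (f := fun l : ℝ => l ^ t) (by simp)).smul_measure ENNReal.ofReal_ne_top

/-- A return probability above `r ^ t` forces spectral mass in `[r, 1]`. -/
lemma IsLocalSpectralMeasure.sub_pow_le {W : Type u} {H : SimpleGraph W} {x : W} {μ : Measure ℝ}
    (hμ : IsLocalSpectralMeasure H x μ) {r : ℝ} (hr : 0 ≤ r) (t : ℕ) :
    transitionPow H t x x - r ^ t ≤ μ.real (Set.Icc r 1) := by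
  have := hμ.isProbabilityMeasure
  have hae : ∀ᵐ l ∂μ, l ∈ Set.Icc (0 : ℝ) 1 :=
    (prob_compl_eq_zero_iff measurableSet_Icc).mpr hμ.measure_Icc
  have hint : Integrable (fun l => r ^ t + (Set.Icc r 1).indicator (fun _ => (1 : ℝ)) l) μ :=
    (integrable_const _).add ((integrable_const _).indicator measurableSet_Icc)
  have hle : ∫ l, l ^ t ∂μ ≤ ∫ l, r ^ t + (Set.Icc r 1).indicator (fun _ => (1 : ℝ)) l ∂μ := by
    refine integral_mono_of_nonneg ?_ hint ?_
    · filter_upwards [hae] with l hl using pow_nonneg hl.1 t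
    · filter_upwards [hae] with l hl
      by_cases h : r ≤ l
      · rw [Set.indicator_of_mem (show l ∈ Set.Icc r 1 from ⟨h, hl.2⟩)]
        linarith [pow_le_one₀ hl.1 hl.2 (n := t), pow_nonneg hr t]
      · rw [Set.indicator_of_notMem fun h' => h h'.1, add_zero]
        exact pow_le_pow_left₀ hl.1 (not_le.mp h).le t
  rw [hμ.moment, integral_add (integrable_const _)
    ((integrable_const _).indicator measurableSet_Icc), integral_const,
    integral_indicator_const _ measurableSet_Icc] at hle
  simp only [probReal_univ, smul_eq_mul, one_mul, mul_one] at hle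
  linarith

/-! ### Positivity of the spectral mass near 1 on a single finite graph -/

lemma walkWeight_mul_transitionPow (t : ℕ) (x y : V) :
    walkWeight G x * transitionPow G t x y = walkWeight G y * transitionPow G t y x := by
  classical
  induction t generalizing x y with
  | zero =>
    by_cases h : x = y
    · rw [h]
    · simp [transitionPow, h, Ne.symm h]
  | succ t ih =>
    -- The first step is split off on the left and the last step on the right, since reversal
    -- exchanges them.
    rw [transitionPow_succ, tsum_fintype, ← transitionMatrix_pow G (t + 1) y x, pow_succ,
      Matrix.mul_apply, Finset.mul_sum, Finset.mul_sum]
    refine Finset.sum_congr rfl fun z _ => ?_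
    rw [transitionMatrix_pow, Matrix.of_apply, ← mul_assoc, walkWeight_mul_transition,
      ← mul_assoc, ← ih z y]
    ring

lemma sum_transitionPow (t : ℕ) (x : V) : ∑ y, transitionPow G t x y = 1 := by
  classical
  induction t generalizing x with
  | zero => simp [transitionPow]
  | succ t ih =>
    simp only [transitionPow_succ, tsum_fintype]
    rw [Finset.sum_comm]
    simp only [← Finset.mul_sum, ih, mul_one]
    rw [← tsum_fintype (L := .unconditional V)]
    exact (hasSum_transition (Set.toFinite _)).tsum_eq

/-- By pigeonhole some `y` carries mass at least `1 / N` after `t` steps, where `N` is the number of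
vertices. Weights lie in `[1, N]`, so by reversibility the return from `y` has probability at least
`1 / N ^ 2`. The bound does not depend on `t`. -/
lemma inv_card_pow_le_transitionPow (t : ℕ) (x : V) :
    ((Fintype.card V : ℝ) ^ 3)⁻¹ ≤ transitionPow G (t + t) x x := by
  have hN : (0 : ℝ) < Fintype.card V := by exact_mod_cast Fintype.card_pos_iff.mpr ⟨x⟩
  obtain ⟨y, hy⟩ : ∃ y, (Fintype.card V : ℝ)⁻¹ ≤ transitionPow G t x y := by
    by_contra! h
    have h1 := Finset.sum_lt_sum_of_nonempty ⟨x, Finset.mem_univ x⟩ fun y _ => h y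
    rw [sum_transitionPow, Finset.sum_const, Finset.card_univ, nsmul_eq_mul,
      mul_inv_cancel₀ hN.ne'] at h1
    exact lt_irrefl _ h1
  have h1 : transitionPow G t x y ≤ Fintype.card V * transitionPow G t y x :=
    calc transitionPow G t x y ≤ walkWeight G x * transitionPow G t x y :=
          le_mul_of_one_le_left (transitionPow_nonneg _ _ _) (one_le_walkWeight G x)
      _ = walkWeight G y * transitionPow G t y x := walkWeight_mul_transitionPow G t x y
      _ ≤ _ := mul_le_mul_of_nonneg_right (walkWeight_le_card G y) (transitionPow_nonneg _ _ _)
  have h2 : (Fintype.card V : ℝ)⁻¹ * (Fintype.card V : ℝ)⁻¹ ≤ transitionPow G t y x := by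
    rw [← div_eq_inv_mul, div_le_iff₀ hN, mul_comm]
    exact hy.trans h1
  refine le_trans ?_ (transitionPow_mul_le (fun _ => Set.toFinite _) t t x x y)
  calc ((Fintype.card V : ℝ) ^ 3)⁻¹
      = (Fintype.card V : ℝ)⁻¹ * ((Fintype.card V : ℝ)⁻¹ * (Fintype.card V : ℝ)⁻¹) := by
        rw [← mul_inv, ← mul_inv]; ring
    _ ≤ _ := mul_le_mul hy h2 (by positivity) (transitionPow_nonneg _ _ _)

lemma localSpectralMeasure_Icc_pos (x : V) {r : ℝ} (hr0 : 0 ≤ r) (hr1 : r < 1) :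
    0 < (localSpectralMeasure G x).real (Set.Icc r 1) := by
  have hN : (0 : ℝ) < Fintype.card V := by exact_mod_cast Fintype.card_pos_iff.mpr ⟨x⟩
  obtain ⟨t, ht⟩ := exists_pow_lt_of_lt_one (inv_pos.mpr (pow_pos hN 3)) hr1
  have h1 := (isLocalSpectralMeasure_localSpectralMeasure G x).sub_pow_le hr0 (t + t)
  have h2 := inv_card_pow_le_transitionPow G t x
  have h3 : r ^ (t + t) ≤ r ^ t := pow_le_pow_of_le_one hr0 hr1.le (Nat.le_add_left t t)
  linarith

/-- An average return probability above `r ^ t` forces a fraction of the eigenvalues into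
`[r, 1]`. -/
lemma ofReal_average_sub_pow_le {r : ℝ} (hr : 0 ≤ r) (t : ℕ) :
    ENNReal.ofReal ((∑ x, transitionPow G t x x) / Fintype.card V - r ^ t) ≤
      empiricalSpectralMeasure G (Set.Icc r 1) := by
  obtain ⟨l, c, hl, -, -, h2, h3, h4⟩ := exists_spectral_decomposition G
  rcases isEmpty_or_nonempty V with hV | hV
  · simp only [Finset.univ_eq_empty, Finset.sum_empty, zero_div, zero_sub,
      ENNReal.ofReal_of_nonpos (neg_nonpos.mpr (pow_nonneg hr t)), zero_le]
  have hN : (0 : ℝ) < Fintype.card V := by exact_mod_cast Fintype.card_pos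
  -- The trace identity, from the column sums of `c`.
  have h5 : ∑ x, transitionPow G t x x = ∑ i, l i ^ t := by
    simp only [h3]
    rw [Finset.sum_comm]
    simp only [← Finset.mul_sum, h2, mul_one]
  have h6 : ∑ i, l i ^ t ≤ Fintype.card V * r ^ t + ∑ i, (Set.Icc r 1).indicator 1 (l i) := by
    rw [← nsmul_eq_mul, ← Finset.card_univ, ← Finset.sum_const, ← Finset.sum_add_distrib]
    refine Finset.sum_le_sum fun i _ => ?_
    by_cases h : r ≤ l i
    · rw [Set.indicator_of_mem (show l i ∈ Set.Icc r 1 from ⟨h, (hl i).2⟩), Pi.one_apply]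
      linarith [pow_le_one₀ (hl i).1 (hl i).2 (n := t), pow_nonneg hr t]
    · rw [Set.indicator_of_notMem fun h' => h h'.1, add_zero]
      exact pow_le_pow_left₀ (hl i).1 (not_le.mp h).le t
  have h7 : ∑ i, (Set.Icc r 1).indicator (1 : ℝ → ℝ≥0∞) (l i) =
      ENNReal.ofReal (∑ i, (Set.Icc r 1).indicator 1 (l i)) := by
    rw [ENNReal.ofReal_sum_of_nonneg fun i _ => Set.indicator_nonneg
      (f := (1 : ℝ → ℝ)) (fun _ _ => zero_le_one) _]
    refine Finset.sum_congr rfl fun i _ => ?_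
    by_cases h : l i ∈ Set.Icc r 1
    · simp only [Set.indicator_of_mem h, Pi.one_apply, ENNReal.ofReal_one]
    · simp only [Set.indicator_of_notMem h, ENNReal.ofReal_zero]
  rw [h4 _ measurableSet_Icc, h7, ← ENNReal.ofReal_natCast, ← ENNReal.ofReal_inv_of_pos hN,
    ← ENNReal.ofReal_mul (inv_nonneg.mpr hN.le)]
  refine ENNReal.ofReal_le_ofReal ?_
  rw [h5, ← div_eq_inv_mul, sub_le_iff_le_add, div_add' _ _ _ hN.ne', div_le_div_iff_of_pos_right hN]
  linarith

end SpectralDecomposition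

/-! ### Local weak limits of spectral radius one -/

section LocalWeakLimit

lemma localProfile_apply {V : Type u} [Fintype V] [Nonempty V] (G : SimpleGraph V)
    {s : Set RootedGraphSpace.{u}} (hs : MeasurableSet s) :
    (localProfile G : Measure RootedGraphSpace.{u}) s = ENNReal.ofReal
      (({x : V | RootedGraphSpace.mk (componentAt G x) ∈ s}.ncard : ℝ) / Fintype.card V) := by
  classical
  have hN : (0 : ℝ) < Fintype.card V := by exact_mod_cast Fintype.card_pos
  change ((Fintype.card V : ℝ≥0∞)⁻¹ •
    ∑ x : V, Measure.dirac (RootedGraphSpace.mk (componentAt G x))) s = _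
  rw [Measure.smul_apply, Measure.finsetSum_apply, smul_eq_mul, ENNReal.ofReal_div_of_pos hN,
    ENNReal.ofReal_natCast, ENNReal.ofReal_natCast, ENNReal.div_eq_inv_mul]
  congr 1
  simp only [Measure.dirac_apply' _ hs, Set.indicator_apply, Pi.one_apply]
  rw [Finset.sum_boole, Set.ncard_eq_toFinset_card']
  congr 2
  ext x
  simp

/-- The time after which the bound holds depends on the rooted graph. Continuity from below along
the increasing events `B T` makes one time serve for most graphs. -/
lemma exists_lt_measure_returnProb (L : ProbabilityMeasure RootedGraphSpace.{u})
    (hL : (L : Measure RootedGraphSpace.{u}) {g | RootedGraphSpace.spectralRadius g = 1} = 1)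
    {r : ℝ} (hr0 : 0 < r) (hr1 : r < 1) {a : ℝ≥0∞} (ha : a < 1) :
    ∃ t : ℕ, a < (L : Measure RootedGraphSpace.{u})
      {g | 2 * r ^ t < RootedGraphSpace.returnProb t g} := by
  set B : ℕ → Set RootedGraphSpace.{u} :=
    fun T => {g | ∀ t ≥ T, 2 * r ^ t < RootedGraphSpace.returnProb t g}
  have hB : Monotone B := fun S T hST g hg t ht => hg t (hST.trans ht)
  have hU : (L : Measure RootedGraphSpace.{u}) (⋃ T, B T) = 1 := by
    refine le_antisymm prob_le_one (hL.symm.trans_le (measure_mono fun g hg => ?_))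
    obtain ⟨T, hT⟩ :=
      eventually_atTop.mp (RootedGraphSpace.eventually_lt_returnProb hg hr0 hr1)
    exact Set.mem_iUnion.mpr ⟨T, hT⟩
  have hlim := tendsto_measure_iUnion_atTop (μ := (L : Measure RootedGraphSpace.{u})) hB
  rw [hU] at hlim
  obtain ⟨T, hT⟩ := (hlim.eventually_const_lt ha).exists
  exact ⟨T, hT.trans_le (measure_mono fun g hg => hg T le_rfl)⟩

/-- Portmanteau for an open set: the liminf of the masses given by the local profiles is at least
the mass given by `L`. -/
lemma exists_eventually_lt_ncard (V : ℕ → Type u) [∀ n, Fintype (V n)] [∀ n, Nonempty (V n)]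
    (G : ∀ n, SimpleGraph (V n)) (L : ProbabilityMeasure RootedGraphSpace.{u})
    (hG : Tendsto (fun n => localProfile (G n)) atTop (𝓝 L))
    (hL : (L : Measure RootedGraphSpace.{u}) {g | RootedGraphSpace.spectralRadius g = 1} = 1)
    {r : ℝ} (hr0 : 0 < r) (hr1 : r < 1) {q : ℝ} (hq : q < 1) :
    ∃ t : ℕ, ∀ᶠ n in atTop, q * Fintype.card (V n) ≤
      {x : V n | 2 * r ^ t < transitionPow (G n) t x x}.ncard := by
  obtain ⟨t, ht⟩ := exists_lt_measure_returnProb L hL hr0 hr1 (a := ENNReal.ofReal q)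
    (ENNReal.ofReal_lt_one.mpr hq)
  have hopen : IsOpen {g : RootedGraphSpace.{u} | 2 * r ^ t < RootedGraphSpace.returnProb t g} :=
    RootedGraphSpace.isOpen_returnProb t (Set.Ioi (2 * r ^ t))
  have hlim := eventually_lt_of_lt_liminf
    (ht.trans_le (ProbabilityMeasure.le_liminf_measure_open_of_tendsto hG hopen))
  refine ⟨t, hlim.mono fun n hn => ?_⟩
  have hN : (0 : ℝ) < Fintype.card (V n) := by exact_mod_cast Fintype.card_pos
  rw [localProfile_apply (G n) hopen.measurableSet] at hn
  have h := (ENNReal.ofReal_le_ofReal_iff (by positivity)).mp hn.le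
  rw [le_div_iff₀ hN] at h
  simpa only [Set.mem_ofPred_eq, RootedGraphSpace.returnProb_componentAt] using h

end LocalWeakLimit

/-! ### The two conclusions -/

theorem mainTheorem7 (V : ℕ → Type u) [∀ n, Fintype (V n)] [∀ n, Nonempty (V n)]
    (G : ∀ n, SimpleGraph (V n)) (L : ProbabilityMeasure RootedGraphSpace.{u})
    (hG : Tendsto (fun n => localProfile (G n)) atTop (𝓝 L))
    (hL : (L : Measure RootedGraphSpace.{u}) {g | RootedGraphSpace.spectralRadius g = 1} = 1)
    (ρ : ℝ) (hρ : ρ < 1) :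
    0 < liminf (fun n => empiricalSpectralMeasure (G n) (Set.Icc ρ 1)) atTop ∧
    Tendsto
      (fun ε : ℝ => ⨆ n : ℕ,
        ((({x : V n | (localSpectralMeasure (G n) x).real (Set.Icc ρ 1) ≤ ε}).ncard : ℝ) /
          (Fintype.card (V n) : ℝ)))
      (𝓝[>] 0) (𝓝 0) := by
  -- Raising `ρ` only shrinks the interval, and a positive `r` makes `r ^ t` a usable lower bound.
  obtain ⟨r, hρr, hr0, hr1⟩ : ∃ r : ℝ, ρ ≤ r ∧ 0 < r ∧ r < 1 :=
    ⟨max ρ (1 / 2), le_max_left _ _, lt_max_of_lt_right (by norm_num), max_lt hρ (by norm_num)⟩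
  have hsub : Set.Icc r 1 ⊆ Set.Icc ρ 1 := Set.Icc_subset_Icc_left hρr
  have hN : ∀ n, (0 : ℝ) < Fintype.card (V n) := fun n => by exact_mod_cast Fintype.card_pos
  constructor
  -- Any proportion `q > 1 / 2` works: the average return probability is at least `2 * q * r ^ t`,
  -- which leaves `(2 * q - 1) * r ^ t`, here `r ^ t / 2`.
  · obtain ⟨t, ht⟩ := exists_eventually_lt_ncard V G L hG hL hr0 hr1 (q := 3 / 4) (by norm_num)
    have hpos : 0 < ENNReal.ofReal (r ^ t / 2) := ENNReal.ofReal_pos.mpr (by positivity)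
    refine hpos.trans_le (le_liminf_of_le (by isBoundedDefault) (ht.mono fun n hn => ?_))
    refine (ENNReal.ofReal_le_ofReal ?_).trans
      ((ofReal_average_sub_pow_le (G n) hr0.le t).trans (measure_mono hsub))
    classical
    have h1 : ({x : V n | 2 * r ^ t < transitionPow (G n) t x x}.ncard : ℝ) * (2 * r ^ t) ≤
        ∑ x, transitionPow (G n) t x x := by
      rw [Set.ncard_eq_toFinset_card', ← nsmul_eq_mul]
      refine (Finset.card_nsmul_le_sum _ (fun x => transitionPow (G n) t x x) _ fun x hx => ?_).trans
        (Finset.sum_le_univ_sum_of_nonneg fun x => transitionPow_nonneg t x x)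
      exact (Set.mem_toFinset.mp hx).le
    have hrt := pow_pos hr0 t
    rw [le_sub_iff_add_le, le_div_iff₀ (hN n)]
    nlinarith [mul_le_mul_of_nonneg_right hn (by positivity : 0 ≤ 2 * r ^ t)]
  · have hmono : ∀ n (x : V n), (localSpectralMeasure (G n) x).real (Set.Icc r 1) ≤
        (localSpectralMeasure (G n) x).real (Set.Icc ρ 1) := by
      intro n x
      have := (isLocalSpectralMeasure_localSpectralMeasure (G n) x).isProbabilityMeasure
      exact measureReal_mono hsub
    rw [Metric.tendsto_nhds]
    intro η hη
    obtain ⟨t, ht⟩ := exists_eventually_lt_ncard V G L hG hL hr0 hr1 (q := 1 - η / 2)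
      (by linarith)
    obtain ⟨N, hNt⟩ := eventually_atTop.mp ht
    -- Only finitely many pairs `(n, x)` with `n < N` occur, each with positive mass, so for small
    -- `ε` these graphs contribute nothing to the supremum.
    have hsmall : ∀ᶠ ε : ℝ in 𝓝[>] 0, ∀ n ∈ Set.Iio N, ∀ x : V n,
        ε < (localSpectralMeasure (G n) x).real (Set.Icc r 1) := by
      rw [eventually_all_finite (Set.finite_Iio N)]
      intro n _
      rw [eventually_all]
      exact fun x => nhdsWithin_le_nhds
        (eventually_lt_nhds (localSpectralMeasure_Icc_pos (G n) x hr0.le hr1))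
    have hlt : ∀ᶠ ε : ℝ in 𝓝[>] 0, ε < r ^ t :=
      nhdsWithin_le_nhds (eventually_lt_nhds (pow_pos hr0 t))
    filter_upwards [hsmall, hlt] with ε h1 h2
    rw [Real.dist_0_eq_abs, abs_of_nonneg (Real.iSup_nonneg fun n => by positivity)]
    refine lt_of_le_of_lt (ciSup_le fun n => ?_) (half_lt_self hη)
    rw [div_le_iff₀ (hN n)]
    rcases lt_or_ge n N with hn | hn
    · have : {x : V n | (localSpectralMeasure (G n) x).real (Set.Icc ρ 1) ≤ ε} = ∅ := by
        refine Set.eq_empty_of_forall_notMem fun x hx => ?_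
        exact absurd ((h1 n hn x).trans_le (hmono n x)) (not_lt.mpr hx)
      rw [this, Set.ncard_empty, Nat.cast_zero]
      exact mul_nonneg (half_pos hη).le (hN n).le
    -- A return probability above `2 * r ^ t` forces mass above `r ^ t > ε`, so exceptional vertices
    -- lie in the complement, of proportion at most `η / 2`.
    · have hcompl : {x : V n | (localSpectralMeasure (G n) x).real (Set.Icc ρ 1) ≤ ε} ⊆
          {x : V n | 2 * r ^ t < transitionPow (G n) t x x}ᶜ := by
        intro x hx hx'
        have h3 := (isLocalSpectralMeasure_localSpectralMeasure (G n) x).sub_pow_le hr0.le t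
        have h4 := hmono n x
        rw [Set.mem_ofPred_eq] at hx hx'
        linarith
      have h3 : (_ : ℝ) ≤ _ := Nat.cast_le.mpr (Set.ncard_le_ncard hcompl (Set.toFinite _))
      have h4 := Set.ncard_add_ncard_compl {x : V n | 2 * r ^ t < transitionPow (G n) t x x}
      rw [Nat.card_eq_fintype_card] at h4
      have h5 : (({x : V n | 2 * r ^ t < transitionPow (G n) t x x}.ncard : ℝ)) +
          ({x : V n | 2 * r ^ t < transitionPow (G n) t x x}ᶜ.ncard : ℝ) =
            Fintype.card (V n) := by exact_mod_cast h4
      have h6 := hNt n hn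
      linarith
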